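/- Let $I=[0,1]$ with its usual metric $d$, and let $C_s(I)$ be the set of continuous surjective maps $I\to I$. A non-autonomous system is a sequence $f_{1,\infty}=(f_n)_{n\ge 1}$ in $C_s(I)$, with iterates $f_{1,\infty}^0=\mathrm{id}$ and $f_{1,\infty}^n=f_n\circ\dots\circ f_1$. For $x,y\in I$ and $t>0$ let $\psi_{xy}(t)$ and $\psi^*_{xy}(t)$ be the lower and the upper limit, as $n\to\infty$, of $\frac1n\#\{0\le j<n:\ d(f_{1,\infty}^j(x),f_{1,\infty}^j(y))<t\}$. The system is distributionally chaotic of type 1 (DC1) if there is an uncountable set $S\subseteq I$ such that for all $x\neq y$ in $S$ one has $\psi^*_{xy}(t)=1$ for all $t>0$ and $\psi_{xy}(t)=0$ for some $t>0$. Let $\rho$ be a metric on $C_s(I)$, and equip spaces of systems with the (extended) metric $\rho_{\mathcal F}(f_{1,\infty},g_{1,\infty})=\sup_{n}\rho(f_n,g_n)$. (i) Suppose that uniform closeness implies $\rho$-closeness, that is, for every $\varepsilon>0$ there is $\delta>0$ such that all $f,g\in C_s(I)$ with $d(f(x),g(x))<\delta$ for every $x\in I$ satisfy $\rho(f,g)<\varepsilon$.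 (This holds, for example, for the supremum metric and for the integral metric $\int_0^1 d(f(x),g(x))\,dx$.) Then the DC1 systems are dense in the space $\mathcal F_p(I)$ of systems that converge pointwise to a continuous (not necessarily surjective) map $I\to I$: for every $f_{1,\infty}\in\mathcal F_p(I)$ and $\varepsilon>0$ there is a DC1 system $g_{1,\infty}\in\mathcal F_p(I)$ with $\rho_{\mathcal F}(f_{1,\infty},g_{1,\infty})<\varepsilon$. (ii) Suppose only that $\rho$ is continuous with respect to uniform convergence, that is, for every $f\in C_s(I)$ and $\varepsilon>0$ there is $\delta>0$ such that every $g\in C_s(I)$ with $d(f(x),g(x))<\delta$ for every $x\in I$ satisfies $\rho(f,g)<\varepsilon$. Then the DC1 systems are dense, in the same sense, in the space of systems that converge in the metric $\rho$ to an element of $C_s(I)$. (For the supremum metric this is the space of uniformly convergent systems.) -/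

import Mathlib

open Filter Topology
open scoped ENNReal

noncomputable section

/-- The set `C_s(X)` of continuous surjective self-maps of `X`. This is deliberately a plain
definition, so that it carries no metric (in particular not the supremum metric) by default. -/
def Cs (X : Type*) [TopologicalSpace X] : Type _ :=
  {f : C(X, X) // Function.Surjective f}

instance {X : Type*} [TopologicalSpace X] : CoeFun (Cs X) (fun _ => X → X) :=
  ⟨fun f => f.1⟩

/-- A non-autonomous discrete dynamical system on `X`: a sequence of continuous surjective
self-maps. The map written `f_{n+1}` in the literature, `n ≥ 0`, is `f n` here. -/
abbrev Nads (X : Type*) [TopologicalSpace X] : Type _ := ℕ → Cs X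

namespace Nads

section Topological

variable {X : Type*} [TopologicalSpace X]

/-- The `n`-th iterate `f_n ∘ ⋯ ∘ f_1` of a non-autonomous system. -/
def iter (f : Nads X) : ℕ → X → X
  | 0, x => x
  | n + 1, x => f n (iter f n x)

/-- The system converges pointwise to a continuous map, which need not be surjective. -/
def ConvergesPointwise (f : Nads X) : Prop :=
  ∃ g : C(X, X), ∀ x : X, Tendsto (fun n => f n x) atTop (𝓝 (g x))

/-- The system converges, with respect to the given metric on `C_s(X)`, to an element of
`C_s(X)`. -/
def ConvergesInMetric [MetricSpace (Cs X)] (f : Nads X) : Prop :=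
  ∃ g : Cs X, ∀ ε > 0, ∃ N : ℕ, ∀ n > N, dist (f n) g < ε

/-- The (extended) metric `sup_n ρ(f_n, g_n)` on systems, where `ρ` is the given metric on
`C_s(X)`. -/
def supDist [MetricSpace (Cs X)] (f g : Nads X) : ℝ≥0∞ :=
  ⨆ n, edist (f n) (g n)

/-- The members of `F` with the property `P` are dense in `F` for the metric
`sup_n ρ(f_n, g_n)`. -/
def DenseIn [MetricSpace (Cs X)] (P : Nads X → Prop) (F : Set (Nads X)) : Prop :=
  ∀ f ∈ F, ∀ ε : ℝ, 0 < ε → ∃ g ∈ F, P g ∧ supDist f g < ENNReal.ofReal ε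

end Topological

section Chaos

variable {X : Type*} [MetricSpace X]

open scoped Classical in
/-- The proportion of the times `0 ≤ j < n` at which the trajectories of `x` and `y` are at
distance less than `t`. -/
def closeFreq (f : Nads X) (x y : X) (t : ℝ) (n : ℕ) : ℝ :=
  (1 / (n : ℝ)) *
    (((Finset.range n).filter fun j => dist (iter f j x) (iter f j y) < t).card : ℝ)

/-- The lower distributional function. -/
def lowerDistrib (f : Nads X) (x y : X) (t : ℝ) : ℝ :=
  liminf (fun n => closeFreq f x y t n) atTop

/-- The upper distributional function. -/
def upperDistrib (f : Nads X) (x y : X) (t : ℝ) : ℝ :=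
  limsup (fun n => closeFreq f x y t n) atTop

/-- `x, y` is a DC1-scrambled pair of `f`. -/
def IsDC1Pair (f : Nads X) (x y : X) : Prop :=
  (∀ t > 0, upperDistrib f x y t = 1) ∧ ∃ t > 0, lowerDistrib f x y t = 0

/-- `f` is distributionally chaotic of type 1: it has an uncountable set all of whose pairs of
distinct points are DC1-scrambled. -/
def IsDC1 (f : Nads X) : Prop :=
  ∃ S : Set X, ¬ S.Countable ∧ ∀ x ∈ S, ∀ y ∈ S, x ≠ y → IsDC1Pair f x y

end Chaos

end Nads

/-- The given metric on `C_s(X)` is continuous with respect to uniform convergence: maps that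
are uniformly close enough to a given map are close to it in the given metric. -/
def MetricContinuousForSup (X : Type*) [MetricSpace X] [MetricSpace (Cs X)] : Prop :=
  ∀ f : Cs X, ∀ ε > 0, ∃ δ > 0, ∀ g : Cs X, (∀ x, dist (f x) (g x) < δ) → dist f g < ε

/-- The given metric on `C_s(X)` is uniformly continuous with respect to the supremum metric:
maps that are uniformly close are close in the given metric. -/
def MetricUniformlyContinuousForSup (X : Type*) [MetricSpace X] [MetricSpace (Cs X)] : Prop :=
  ∀ ε > 0, ∃ δ > 0, ∀ f g : Cs X, (∀ x, dist (f x) (g x) < δ) → dist f g < ε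

end

/-!
The limit map `φ` has a fixed point `p`. Near `p` pick two points `q false < q true`. A map `f` that
is close to `φ` at these two points sends short intervals to the right of them into a small
interval `[lo, hi]` around `p`. Changing `f` inside these two short intervals only, with values in
`[lo, hi]`, produces a map that is uniformly close to `f`, is still surjective, and stretches a
subinterval of each of them affinely over `[lo, hi]`, which contains both: a two-symbol horseshoe
(`exists_horseshoe_perturbation`). The set `[lo, hi]` and the separation of the two pieces depend
only on `φ` and on the allowed size of the change, although the pieces themselves depend on `f`.

If all maps of a system from some time on have horseshoes over the same set with the same
separation, then every sequence of symbols is the itinerary of a point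
(`Nads.exists_following`). Two trajectories are far apart whenever their symbols differ, and close
at the start of any long run of equal symbols, because every step at least doubles the distance of
points in the same piece. It remains to take uncountably many symbol sequences (`itinerary`) any two
of which agree on infinitely many blocks of times, and differ on infinitely many, each block being
much longer than all the time before it; this gives `Nads.isDC1_of_hasHorseshoe`.

For pointwise convergence, the maps are changed in intervals `(q b, q b + 1 / (n + 1))`. Every point
is outside these for large `n`, the left end points included, so the limit does not change. For
convergence in the metric, all late maps are replaced by one and the same perturbation of the limit,
so that continuity of the metric is needed at the limit map only.
-/

/-! ### Frequencies along rapidly growing blocks -/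

namespace Nads

variable {X : Type*} [MetricSpace X]

theorem closeFreq_nonneg (f : Nads X) (x y : X) (t : ℝ) (n : ℕ) : 0 ≤ closeFreq f x y t n := by
  unfold closeFreq
  positivity

theorem closeFreq_le_one (f : Nads X) (x y : X) (t : ℝ) (n : ℕ) : closeFreq f x y t n ≤ 1 := by
  classical
  unfold closeFreq
  rw [one_div, inv_mul_eq_div]
  refine div_le_one_of_le₀ ?_ (Nat.cast_nonneg n)
  exact_mod_cast (Finset.card_filter_le _ _).trans (Finset.card_range n).le

theorem upperDistrib_eq_one {f : Nads X} {x y : X} {t : ℝ}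
    (h : ∀ ε > 0, ∃ᶠ n in atTop, 1 - ε ≤ closeFreq f x y t n) : upperDistrib f x y t = 1 := by
  have hb : IsBoundedUnder (· ≤ ·) atTop (closeFreq f x y t) :=
    isBoundedUnder_of ⟨1, closeFreq_le_one f x y t⟩
  have hc : IsBoundedUnder (· ≥ ·) atTop (closeFreq f x y t) :=
    isBoundedUnder_of ⟨0, closeFreq_nonneg f x y t⟩
  refine le_antisymm (limsup_le_of_le hc.isCoboundedUnder_le
    (.of_forall (closeFreq_le_one f x y t))) (le_of_forall_pos_le_add fun ε hε => ?_)
  have := le_limsup_of_frequently_le (h ε hε) hb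
  unfold upperDistrib
  linarith

theorem lowerDistrib_eq_zero {f : Nads X} {x y : X} {t : ℝ}
    (h : ∀ ε > 0, ∃ᶠ n in atTop, closeFreq f x y t n ≤ ε) : lowerDistrib f x y t = 0 := by
  have hb : IsBoundedUnder (· ≤ ·) atTop (closeFreq f x y t) :=
    isBoundedUnder_of ⟨1, closeFreq_le_one f x y t⟩
  have hc : IsBoundedUnder (· ≥ ·) atTop (closeFreq f x y t) :=
    isBoundedUnder_of ⟨0, closeFreq_nonneg f x y t⟩
  refine le_antisymm (le_of_forall_pos_le_add fun ε hε => ?_)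
    (le_liminf_of_le hb.isCoboundedUnder_ge (.of_forall (closeFreq_nonneg f x y t)))
  have := liminf_le_of_frequently_le (h ε hε) hc
  unfold lowerDistrib
  linarith

end Nads

/-- The left end of the `k`-th block `[blockStart k, blockStart (k + 1))` of times. Since
`blockStart (k + 1) = blockStart k ^ 2`, each block outweighs everything before it. -/
def blockStart (k : ℕ) : ℕ := 2 ^ 2 ^ k

theorem blockStart_succ (k : ℕ) : blockStart (k + 1) = blockStart k ^ 2 := by
  simp [blockStart, pow_succ, pow_mul]

theorem blockStart_pos (k : ℕ) : 0 < blockStart k := by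
  simp [blockStart]

theorem tendsto_blockStart : Tendsto blockStart atTop atTop :=
  (tendsto_pow_atTop_atTop_of_one_lt one_lt_two).comp
    (tendsto_pow_atTop_atTop_of_one_lt one_lt_two)

theorem log_log_eq_of_mem_block {k j : ℕ} (h₁ : blockStart k ≤ j) (h₂ : j < blockStart (k + 1)) :
    Nat.log 2 (Nat.log 2 j) = k := by
  have hj : j ≠ 0 := ((blockStart_pos k).trans_le h₁).ne'
  have h₃ : 2 ^ k ≤ Nat.log 2 j := Nat.le_log_of_pow_le one_lt_two h₁
  have h₄ : Nat.log 2 j < 2 ^ (k + 1) := Nat.log_lt_of_lt_pow hj h₂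
  refine (Nat.log_eq_iff (Or.inr ⟨one_lt_two, ?_⟩)).2 ⟨h₃, h₄⟩
  have : 0 < 2 ^ k := by positivity
  omega

/-- All but a negligible part of the times before the end of block `k` belong to block `k`,
even after trimming it by a fixed amount `C` at both ends. -/
theorem tendsto_block_error (C : ℕ) :
    Tendsto (fun k => ((blockStart k + 2 * C : ℕ) : ℝ) / (blockStart (k + 1) : ℕ)) atTop (𝓝 0) := by
  have h₁ : Tendsto (fun k => ((blockStart k : ℕ) : ℝ)⁻¹) atTop (𝓝 0) :=
    tendsto_inv_atTop_zero.comp (tendsto_natCast_atTop_atTop.comp tendsto_blockStart)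
  have h₂ := h₁.add ((h₁.pow 2).const_mul (2 * C : ℝ))
  simp only [ne_eq, OfNat.ofNat_ne_zero, not_false_eq_true, zero_pow, mul_zero, add_zero] at h₂
  refine h₂.congr fun k => ?_
  have : ((blockStart k : ℕ) : ℝ) ≠ 0 := by exact_mod_cast (blockStart_pos k).ne'
  rw [blockStart_succ]
  push_cast
  field_simp

namespace Nads

variable {X : Type*} [MetricSpace X]

theorem upperDistrib_eq_one_of_block {f : Nads X} {x y : X} {t : ℝ} (C : ℕ)
    (h : ∃ᶠ k in atTop, ∀ j, C + blockStart k ≤ j → j + C < blockStart (k + 1) →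
      dist (iter f j x) (iter f j y) < t) : upperDistrib f x y t = 1 := by
  classical
  refine upperDistrib_eq_one fun ε hε => ?_
  have hE := (tendsto_block_error C).eventually_lt_const hε
  have := (h.and_eventually hE).mono (q := fun k => 1 - ε ≤ closeFreq f x y t (blockStart (k + 1))) ?_
  · exact (tendsto_blockStart.comp (tendsto_add_atTop_nat 1)).frequently this
  rintro k ⟨hk, hlt⟩
  have hpos : (0 : ℝ) < (blockStart (k + 1) : ℕ) := by exact_mod_cast blockStart_pos (k + 1)
  have hsub : Finset.Ico (C + blockStart k) (blockStart (k + 1) - C) ⊆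
      (Finset.range (blockStart (k + 1))).filter
        fun j => dist (iter f j x) (iter f j y) < t := by
    intro j hj
    rw [Finset.mem_Ico] at hj
    rw [Finset.mem_filter, Finset.mem_range]
    exact ⟨by omega, hk j hj.1 (by omega)⟩
  have hcard := Finset.card_le_card hsub
  rw [Nat.card_Ico] at hcard
  have hcard' : blockStart (k + 1) ≤ ((Finset.range (blockStart (k + 1))).filter
      fun j => dist (iter f j x) (iter f j y) < t).card + (blockStart k + 2 * C) := by omega
  have hreal : ((blockStart (k + 1) : ℕ) : ℝ) ≤ (((Finset.range (blockStart (k + 1))).filter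
      fun j => dist (iter f j x) (iter f j y) < t).card : ℝ) + (blockStart k + 2 * C : ℕ) := by
    exact_mod_cast hcard'
  rw [div_lt_iff₀ hpos] at hlt
  unfold closeFreq
  rw [one_div, inv_mul_eq_div, le_div_iff₀ hpos]
  linarith

theorem lowerDistrib_eq_zero_of_block {f : Nads X} {x y : X} {t : ℝ} (C : ℕ)
    (h : ∃ᶠ k in atTop, ∀ j, C + blockStart k ≤ j → j + C < blockStart (k + 1) →
      t ≤ dist (iter f j x) (iter f j y)) : lowerDistrib f x y t = 0 := by
  classical
  refine lowerDistrib_eq_zero fun ε hε => ?_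
  have hE := (tendsto_block_error C).eventually_lt_const hε
  have := (h.and_eventually hE).mono (q := fun k => closeFreq f x y t (blockStart (k + 1)) ≤ ε) ?_
  · exact (tendsto_blockStart.comp (tendsto_add_atTop_nat 1)).frequently this
  rintro k ⟨hk, hlt⟩
  have hpos : (0 : ℝ) < (blockStart (k + 1) : ℕ) := by exact_mod_cast blockStart_pos (k + 1)
  have hsub : ((Finset.range (blockStart (k + 1))).filter
        fun j => dist (iter f j x) (iter f j y) < t) ⊆
      Finset.range (C + blockStart k) ∪
        Finset.Ico (blockStart (k + 1) - C) (blockStart (k + 1)) := by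
    intro j hj
    rw [Finset.mem_filter, Finset.mem_range] at hj
    rw [Finset.mem_union, Finset.mem_range, Finset.mem_Ico]
    by_contra hcon
    exact (hk j (by omega) (by omega)).not_gt hj.2
  have hcard := (Finset.card_le_card hsub).trans (Finset.card_union_le _ _)
  rw [Nat.card_Ico, Finset.card_range] at hcard
  have hcard' : ((Finset.range (blockStart (k + 1))).filter
      fun j => dist (iter f j x) (iter f j y) < t).card ≤ blockStart k + 2 * C := by omega
  have hreal : (((Finset.range (blockStart (k + 1))).filter
      fun j => dist (iter f j x) (iter f j y) < t).card : ℝ) ≤ (blockStart k + 2 * C : ℕ) := by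
    exact_mod_cast hcard'
  rw [div_lt_iff₀ hpos] at hlt
  unfold closeFreq
  rw [one_div, inv_mul_eq_div, div_le_iff₀ hpos]
  linarith

end Nads

/-! ### Itineraries -/

/-- The itinerary attached to a binary sequence `a`: it is `false` on the even blocks, while the
odd blocks repeat each entry of `a` infinitely often, one entry per block. -/
def itinerary (a : ℕ → Bool) (j : ℕ) : Bool :=
  if Even (Nat.log 2 (Nat.log 2 j)) then false
  else a (Nat.log 2 (Nat.log 2 j) / 2).unpair.1

theorem itinerary_even_block (a : ℕ → Bool) {k j : ℕ} (h₁ : blockStart (2 * k) ≤ j)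
    (h₂ : j < blockStart (2 * k + 1)) : itinerary a j = false := by
  simp [itinerary, log_log_eq_of_mem_block h₁ h₂]

theorem itinerary_odd_block (a : ℕ → Bool) {i l j : ℕ}
    (h₁ : blockStart (2 * Nat.pair i l + 1) ≤ j) (h₂ : j < blockStart (2 * Nat.pair i l + 1 + 1)) :
    itinerary a j = a i := by
  have h : (2 * Nat.pair i l + 1) / 2 = Nat.pair i l := by omega
  simp [itinerary, log_log_eq_of_mem_block h₁ h₂, h]

theorem uncountable_nat_to_bool : Uncountable (ℕ → Bool) := by
  refine ⟨fun h => ?_⟩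
  obtain ⟨f, hf⟩ := exists_surjective_nat (ℕ → Bool)
  obtain ⟨n, hn⟩ := hf fun n => !f n n
  simpa using congrFun hn n

/-! ### Horseshoes produce distributional chaos -/

/-- `f` has a two-symbol horseshoe over `J` with separation `t`: there are two closed subsets of
`J` at distance at least `t` from each other, each of which `f` maps over `J` while at least
doubling distances. -/
def HasHorseshoe {X : Type*} [MetricSpace X] (J : Set X) (t : ℝ) (f : X → X) : Prop :=
  ∃ K : Bool → Set X,
    (∀ b, IsClosed (K b) ∧ K b ⊆ J ∧ J ⊆ f '' K b ∧
      ∀ x ∈ K b, ∀ y ∈ K b, 2 * dist x y ≤ dist (f x) (f y)) ∧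
    ∀ x ∈ K false, ∀ y ∈ K true, t ≤ dist x y

namespace Nads

variable {X : Type*} [MetricSpace X]

theorem continuous_iter (g : Nads X) (n : ℕ) : Continuous (iter g n) := by
  induction n with
  | zero => exact continuous_id
  | succ n ih => exact (g n).1.continuous.comp ih

theorem surjective_iter (g : Nads X) (n : ℕ) : Function.Surjective (iter g n) := by
  induction n with
  | zero => exact Function.surjective_id
  | succ n ih => exact (g n).2.comp ih

/-- If each `K n b` is mapped over `J ⊇ K (n + 1) b`, every sequence of symbols is followed, from
time `N` on, by the trajectory of some point. -/
theorem exists_following [CompactSpace X] {g : Nads X} {N : ℕ} {J : Set X} (hJ : J.Nonempty)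
    {K : ℕ → Bool → Set X} (hcl : ∀ n b, IsClosed (K n b)) (hsub : ∀ n b, K n b ⊆ J)
    (hcov : ∀ n b, J ⊆ g (N + n) '' K n b) (s : ℕ → Bool) :
    ∃ x, ∀ j, iter g (N + j) x ∈ K j (s j) := by
  have key : ∀ m, ∀ y ∈ J, ∃ x, iter g (N + m) x = y ∧ ∀ j < m, iter g (N + j) x ∈ K j (s j) := by
    intro m
    induction m with
    | zero =>
      intro y _
      obtain ⟨x, hx⟩ := surjective_iter g N y
      exact ⟨x, hx, by simp⟩
    | succ m ih =>
      intro y hy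
      obtain ⟨z, hz, hzy⟩ := hcov m (s m) hy
      obtain ⟨x, hx, hxj⟩ := ih z (hsub _ _ hz)
      refine ⟨x, ?_, fun j hj => ?_⟩
      · rw [← hzy, ← hx]
        rfl
      · rcases Nat.lt_succ_iff_lt_or_eq.1 hj with h | rfl
        · exact hxj j h
        · rwa [hx]
  let A : ℕ → Set X := fun m => {x | ∀ j < m, iter g (N + j) x ∈ K j (s j)}
  have hA : ∀ m, IsClosed (A m) := fun m => by
    have : A m = ⋂ j, ⋂ (_ : j < m), iter g (N + j) ⁻¹' K j (s j) := by
      ext x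
      simp [A]
    rw [this]
    exact isClosed_iInter fun j => isClosed_iInter fun _ =>
      (hcl _ _).preimage (continuous_iter g _)
  obtain ⟨x, hx⟩ := IsCompact.nonempty_iInter_of_sequence_nonempty_isCompact_isClosed A
    (fun m x hx j hj => hx j (hj.trans m.lt_succ_self))
    (fun m => by
      obtain ⟨y, hy⟩ := hJ
      obtain ⟨x, -, hx⟩ := key m y hy
      exact ⟨x, hx⟩)
    (hA 0).isCompact hA
  exact ⟨x, fun j => Set.mem_iInter.1 hx (j + 1) j j.lt_succ_self⟩

/-- Two trajectories that visit the same pieces during `m` consecutive steps must be close at the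
start of these steps, because each step doubles their distance. -/
theorem two_pow_mul_dist_le {g : Nads X} {N : ℕ} {K : ℕ → Bool → Set X}
    (hexp : ∀ n b, ∀ x ∈ K n b, ∀ y ∈ K n b, 2 * dist x y ≤ dist (g (N + n) x) (g (N + n) y))
    {s s' : ℕ → Bool} {x y : X} (hx : ∀ j, iter g (N + j) x ∈ K j (s j))
    (hy : ∀ j, iter g (N + j) y ∈ K j (s' j)) (j m : ℕ) (h : ∀ i < m, s (j + i) = s' (j + i)) :
    2 ^ m * dist (iter g (N + j) x) (iter g (N + j) y) ≤
      dist (iter g (N + (j + m)) x) (iter g (N + (j + m)) y) := by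
  induction m with
  | zero => simp
  | succ m ih =>
    have h₁ := ih fun i hi => h i (hi.trans m.lt_succ_self)
    have h₂ := hy (j + m)
    rw [← h m m.lt_succ_self] at h₂
    have h₃ := hexp _ _ _ (hx (j + m)) _ h₂
    calc 2 ^ (m + 1) * dist (iter g (N + j) x) (iter g (N + j) y)
        = 2 * (2 ^ m * dist (iter g (N + j) x) (iter g (N + j) y)) := by ring
      _ ≤ 2 * dist (iter g (N + (j + m)) x) (iter g (N + (j + m)) y) := by linarith
      _ ≤ _ := h₃

/-- A system whose maps eventually all have a horseshoe over the same set, with the same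
separation, is distributionally chaotic of type 1. -/
theorem isDC1_of_hasHorseshoe [CompactSpace X] {g : Nads X} {J : Set X} (hJ : J.Nonempty) {t : ℝ}
    (ht : 0 < t) {N : ℕ} (h : ∀ n ≥ N, HasHorseshoe J t (g n)) : IsDC1 g := by
  choose K hK hsep using fun n => h (N + n) (Nat.le_add_right N n)
  choose p hp using fun a => exists_following hJ (fun n b => (hK n b).1)
    (fun n b => (hK n b).2.1) (fun n b => (hK n b).2.2.1) (itinerary a)
  obtain ⟨D, hD⟩ := Metric.isBounded_iff.1 (isCompact_univ (X := X)).isBounded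
  have hfar : ∀ {a c : ℕ → Bool} {j : ℕ}, itinerary a j ≠ itinerary c j →
      t ≤ dist (iter g (N + j) (p a)) (iter g (N + j) (p c)) := by
    intro a c j hne
    have h₁ := hp a j
    have h₂ := hp c j
    cases ha : itinerary a j <;> cases hc : itinerary c j <;> rw [ha] at h₁ <;> rw [hc] at h₂
    · exact absurd (ha.trans hc.symm) hne
    · exact hsep j _ h₁ _ h₂
    · rw [dist_comm]
      exact hsep j _ h₂ _ h₁
    · exact absurd (ha.trans hc.symm) hne
  have hupper : ∀ a c, ∀ r > 0, upperDistrib g (p a) (p c) r = 1 := by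
    intro a c r hr
    obtain ⟨m, hm⟩ := pow_unbounded_of_one_lt (D / r) one_lt_two
    refine upperDistrib_eq_one_of_block (N + m) (Filter.frequently_atTop.2 fun k₀ =>
      ⟨2 * k₀, by omega, fun j h₁ h₂ => ?_⟩)
    obtain ⟨j, rfl⟩ : ∃ i, j = N + i := ⟨j - N, by omega⟩
    have h₃ := two_pow_mul_dist_le (fun n b => (hK n b).2.2.2) (hp a) (hp c) j m fun i hi => by
      rw [itinerary_even_block (k := k₀) a (by omega) (by omega),
        itinerary_even_block (k := k₀) c (by omega) (by omega)]
    have h₄ := h₃.trans (hD (Set.mem_univ _) (Set.mem_univ _))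
    rw [div_lt_iff₀ hr] at hm
    exact lt_of_mul_lt_mul_left (h₄.trans_lt hm) (by positivity)
  have hlower : ∀ a c, a ≠ c → lowerDistrib g (p a) (p c) t = 0 := by
    intro a c hac
    obtain ⟨i, hi⟩ := Function.ne_iff.1 hac
    refine lowerDistrib_eq_zero_of_block N (Filter.frequently_atTop.2 fun k₀ =>
      ⟨2 * Nat.pair i k₀ + 1, ?_, fun j h₁ h₂ => ?_⟩)
    · have := Nat.right_le_pair i k₀
      omega
    · obtain ⟨j, rfl⟩ : ∃ i, j = N + i := ⟨j - N, by omega⟩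
      refine hfar ?_
      rwa [itinerary_odd_block (i := i) (l := k₀) a (by omega) (by omega),
        itinerary_odd_block (i := i) (l := k₀) c (by omega) (by omega)]
  have hinj : Function.Injective p := by
    intro a c hac
    by_contra hne
    obtain ⟨i, hi⟩ := Function.ne_iff.1 hne
    have hlt : blockStart (2 * Nat.pair i 0 + 1) < blockStart (2 * Nat.pair i 0 + 1 + 1) :=
      Nat.pow_lt_pow_right one_lt_two (Nat.pow_lt_pow_right one_lt_two (Nat.lt_succ_self _))
    have := hfar (a := a) (c := c) (j := blockStart (2 * Nat.pair i 0 + 1)) (by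
      rwa [itinerary_odd_block (i := i) (l := 0) a le_rfl hlt,
        itinerary_odd_block (i := i) (l := 0) c le_rfl hlt])
    rw [hac, dist_self] at this
    exact this.not_gt ht
  refine ⟨Set.range p, fun hc => ?_, ?_⟩
  · have := uncountable_nat_to_bool
    have hcount : (p '' Set.univ).Countable := by rwa [Set.image_univ]
    exact Set.not_countable_univ (Set.countable_of_injective_of_countable_image hinj.injOn hcount)
  · rintro _ ⟨a, rfl⟩ _ ⟨c, rfl⟩ hne
    exact ⟨hupper a c, t, ht, hlower a c fun hac => hne (by rw [hac])⟩

end Nads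

/-! ### Local perturbations of interval maps -/

/-- A map that sends `[q, q + η]` into `[lo, hi]` can be changed inside `(q, q + η)` only, with
values in `[lo, hi]`, so that it becomes the increasing affine map onto `[lo, hi]` on the middle
third. -/
theorem exists_affine_on_middle_third (f : Cs unitInterval) {lo hi q η : ℝ} (hlo : 0 ≤ lo)
    (hlohi : lo < hi) (hhi : hi ≤ 1) (hq : 0 ≤ q) (hη : 0 < η) (hqη : q + η ≤ 1)
    (hf : ∀ x : unitInterval, q ≤ x → (x : ℝ) ≤ q + η → lo ≤ f x ∧ (f x : ℝ) ≤ hi) :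
    ∃ g : Cs unitInterval, (∀ x : unitInterval, ¬ (q < x ∧ (x : ℝ) < q + η) → g x = f x) ∧
      (∀ x : unitInterval, q ≤ x → (x : ℝ) ≤ q + η → lo ≤ g x ∧ (g x : ℝ) ≤ hi) ∧
      ∀ x : unitInterval, q + η / 3 ≤ x → (x : ℝ) ≤ q + 2 * η / 3 →
        (g x : ℝ) = lo + (hi - lo) * (3 * ((x - q) / η) - 1) := by
  -- `u` rescales `[q, q + η]` to `[0, 1]`, and `d u` is the distance to the middle third. The map
  -- `f` is clamped to a band around the affine map `L`; the band has width zero over the middle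
  -- third and contains `[0, 1]` outside `(0, 1)`, for which the slope `6` is enough.
  let u : ℝ → ℝ := fun x => (x - q) / η
  let d : ℝ → ℝ := fun s => max 0 (max (1 / 3 - s) (s - 2 / 3))
  let L : ℝ → ℝ := fun s => lo + (hi - lo) * (3 * s - 1)
  let G : unitInterval → ℝ := fun x =>
    max (min (f x : ℝ) (L (u x) + 6 * d (u x))) (L (u x) - 6 * d (u x))
  have hu : ∀ x, u x * η = x - q := fun x => div_mul_cancel₀ _ hη.ne'
  have hGc : Continuous G := by
    have hfc : Continuous fun x : unitInterval => (f x : ℝ) :=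
      continuous_subtype_val.comp f.1.continuous
    simp only [G, L, d, u]
    fun_prop
  have hout : ∀ x : unitInterval, ¬ (q < x ∧ (x : ℝ) < q + η) → G x = f x := by
    intro x hx
    have h0 : 0 ≤ (f x : ℝ) := (f x).2.1
    have h1 : (f x : ℝ) ≤ 1 := (f x).2.2
    have hcase : u x ≤ 0 ∨ 1 ≤ u x := by
      by_contra! hc
      exact hx ⟨by nlinarith [hu x], by nlinarith [hu x]⟩
    simp only [G]
    generalize u x = s at *
    have hd₁ : 1 / 3 - s ≤ d s := (le_max_left _ _).trans (le_max_right _ _)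
    have hd₂ : s - 2 / 3 ≤ d s := (le_max_right _ _).trans (le_max_right _ _)
    have hup : 1 ≤ L s + 6 * d s := by
      simp only [L]
      rcases hcase with h | h <;> nlinarith
    have hdn : L s - 6 * d s ≤ 0 := by
      simp only [L]
      rcases hcase with h | h <;> nlinarith
    rw [min_eq_left (by linarith), max_eq_left (by linarith)]
  have hin : ∀ x : unitInterval, q ≤ x → (x : ℝ) ≤ q + η → lo ≤ G x ∧ G x ≤ hi := by
    intro x hx₁ hx₂
    obtain ⟨h0, h1⟩ := hf x hx₁ hx₂
    have hs₀ : 0 ≤ u x := div_nonneg (by linarith) hη.le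
    have hs₁ : u x ≤ 1 := div_le_one_of_le₀ (by linarith) hη.le
    simp only [G]
    generalize u x = s at *
    have hd₀ : 0 ≤ d s := le_max_left _ _
    have hd₁ : 1 / 3 - s ≤ d s := (le_max_left _ _).trans (le_max_right _ _)
    have hd₂ : s - 2 / 3 ≤ d s := (le_max_right _ _).trans (le_max_right _ _)
    have hup : lo ≤ L s + 6 * d s := by
      simp only [L]
      rcases le_total (1 / 3) s with h | h <;> nlinarith
    have hdn : L s - 6 * d s ≤ hi := by
      simp only [L]
      rcases le_total s (2 / 3) with h | h <;> nlinarith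
    exact ⟨le_max_of_le_left (le_min h0 hup), max_le ((min_le_left _ _).trans h1) hdn⟩
  have hmid : ∀ x : unitInterval, q + η / 3 ≤ x → (x : ℝ) ≤ q + 2 * η / 3 →
      G x = L (u x) := by
    intro x hx₁ hx₂
    have hs₀ : 1 / 3 ≤ u x := by
      rw [le_div_iff₀ hη]
      linarith
    have hs₁ : u x ≤ 2 / 3 := by
      rw [div_le_iff₀ hη]
      linarith
    have hd : d (u x) = 0 := max_eq_left (max_le (by linarith) (by linarith))
    simp only [G, hd, mul_zero, add_zero, sub_zero]
    exact max_eq_right (min_le_right _ _)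
  have hG01 : ∀ x, G x ∈ unitInterval := by
    intro x
    by_cases hx : q < x ∧ (x : ℝ) < q + η
    · obtain ⟨h0, h1⟩ := hin x hx.1.le hx.2.le
      exact ⟨hlo.trans h0, h1.trans hhi⟩
    · rw [hout x hx]
      exact (f x).2
  let g : C(unitInterval, unitInterval) := ⟨fun x => ⟨G x, hG01 x⟩, hGc.subtype_mk hG01⟩
  have hsurj : Function.Surjective g := by
    intro y
    by_cases hy : lo ≤ (y : ℝ) ∧ (y : ℝ) ≤ hi
    · -- values in `[lo, hi]` are attained on the middle third
      let r : ℝ := (y - lo) / (hi - lo)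
      have hr : (hi - lo) * r = y - lo := mul_div_cancel₀ _ (by linarith)
      have hr₀ : 0 ≤ r := div_nonneg (by linarith) (by linarith)
      have hr₁ : r ≤ 1 := div_le_one_of_le₀ (by linarith) (by linarith)
      have hx₁ : q + η / 3 ≤ q + η / 3 * (1 + r) := by nlinarith
      have hx₂ : q + η / 3 * (1 + r) ≤ q + 2 * η / 3 := by nlinarith
      refine ⟨⟨q + η / 3 * (1 + r), by nlinarith, by nlinarith⟩, Subtype.ext ?_⟩
      change G _ = _
      rw [hmid _ hx₁ hx₂]
      have : u (q + η / 3 * (1 + r)) = (1 + r) / 3 := by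
        simp only [u]
        field_simp
        ring
      simp only [L, this]
      linarith
    · obtain ⟨x, rfl⟩ := f.2 y
      refine ⟨x, Subtype.ext (hout x fun hx => hy (hf x hx.1.le hx.2.le))⟩
  exact ⟨⟨g, hsurj⟩, fun x hx => Subtype.ext (hout x hx), hin, hmid⟩

/-- Near a fixed point of `φ` there are two points `q b` such that every map close to `φ` at these
points acquires a horseshoe, over a set and with a separation that depend on `φ` and `δ` only, by a
`δ`-small change supported in arbitrarily short intervals to the right of the points `q b`. -/
theorem exists_horseshoe_perturbation (φ : C(unitInterval, unitInterval)) {δ : ℝ} (hδ : 0 < δ) :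
    ∃ (J : Set unitInterval) (t κ : ℝ) (q : Bool → unitInterval), J.Nonempty ∧ 0 < t ∧ 0 < κ ∧
      ∀ f : Cs unitInterval, (∀ b, dist (f (q b)) (φ (q b)) < κ) → ∀ η₀ > 0,
        ∃ g : Cs unitInterval, HasHorseshoe J t g ∧ (∀ x, dist (f x) (g x) < δ) ∧
          ∀ x : unitInterval, (∀ b, ¬ ((q b : ℝ) < x ∧ (x : ℝ) < q b + η₀)) → g x = f x := by
  obtain ⟨p, -, hp⟩ := exists_mem_Icc_isFixedPt_of_mapsTo (f := φ) (a := 0) (b := 1)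
    φ.continuous.continuousOn zero_le_one fun x _ => ⟨unitInterval.nonneg', unitInterval.le_one'⟩
  have hp : φ p = p := hp
  have hp₀ : 0 ≤ (p : ℝ) := p.2.1
  have hp₁ : (p : ℝ) ≤ 1 := p.2.2
  let c : ℝ := min (δ / 3) (1 / 2)
  have hc : 0 < c := by positivity
  have hcδ : c ≤ δ / 3 := min_le_left _ _
  have hc1 : c ≤ 1 / 2 := min_le_right _ _
  obtain ⟨c', hc', hφ⟩ := Metric.continuousAt_iff.1 φ.continuous.continuousAt (c / 2) (half_pos hc)
  let lo : ℝ := max 0 (p - c)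
  let hi : ℝ := min 1 (p + c)
  have hlo₀ : 0 ≤ lo := le_max_left _ _
  have hhi₁ : hi ≤ 1 := min_le_left _ _
  have hlo' : p - c ≤ lo := le_max_right _ _
  have hhi' : hi ≤ p + c := min_le_right _ _
  -- two points of `[lo, hi)` at which `φ` stays close to `p`; there is room for them on the left
  -- or on the right of `p`, according to the half of the interval that contains `p`
  obtain ⟨q₁, q₂, hq, hq₁, hq₂, hd₁, hd₂⟩ : ∃ q₁ q₂ : ℝ, q₁ < q₂ ∧ lo ≤ q₁ ∧ q₂ < hi ∧
      |q₁ - p| < c' ∧ |q₂ - p| < c' := by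
    let r : ℝ := min c c' / 2
    have hr : 0 < r := by positivity
    have hrc : r ≤ c / 2 := by
      simp only [r]
      linarith [min_le_left c c']
    have hrc' : r ≤ c' / 2 := by
      simp only [r]
      linarith [min_le_right c c']
    rcases le_total (p : ℝ) (1 / 2) with h | h
    · refine ⟨p, p + r / 2, by linarith, max_le hp₀ (by linarith),
        lt_min (by linarith) (by linarith), ?_, ?_⟩ <;> rw [abs_lt] <;> constructor <;> linarith
    · refine ⟨p - r, p - r / 2, by linarith, max_le (by linarith) (by linarith),
        lt_min (by linarith) (by linarith), ?_, ?_⟩ <;> rw [abs_lt] <;> constructor <;> linarith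
  have hlohi : lo < hi := by linarith
  let Q₁ : unitInterval := ⟨q₁, by linarith, by linarith⟩
  let Q₂ : unitInterval := ⟨q₂, by linarith, by linarith⟩
  refine ⟨{x | lo ≤ (x : ℝ) ∧ (x : ℝ) ≤ hi}, (q₂ - q₁) / 2, c / 2, fun b => cond b Q₂ Q₁,
    ⟨Q₁, hq₁, by change q₁ ≤ hi; linarith⟩, by linarith, half_pos hc, ?_⟩
  intro f hfκ η₀ hη₀
  have hnear : ∀ Q : unitInterval, |(Q : ℝ) - p| < c' → dist (f Q) (φ Q) < c / 2 →
      ∃ ζ > 0, ∀ x : unitInterval, (Q : ℝ) ≤ x → (x : ℝ) ≤ Q + ζ →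
        lo ≤ f x ∧ (f x : ℝ) ≤ hi := by
    intro Q hQ hfQ
    have h₁ : dist (φ Q) p < c / 2 := by
      have := hφ (x := Q) (by rwa [Subtype.dist_eq, Real.dist_eq])
      rwa [hp] at this
    have h₂ : dist (f Q) p < c := by linarith [dist_triangle (f Q) (φ Q) p]
    obtain ⟨ζ, hζ, hfζ⟩ := Metric.continuousAt_iff.1 (f.1.continuous.continuousAt (x := Q))
      (c - dist (f Q) p) (by linarith)
    refine ⟨ζ / 2, half_pos hζ, fun x hx₁ hx₂ => ?_⟩
    have h₃ : dist (f x) (f Q) < c - dist (f Q) p := hfζ (by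
      rw [Subtype.dist_eq, Real.dist_eq, abs_lt]
      constructor <;> linarith)
    have h₄ : dist (f x) p < c := by linarith [dist_triangle (f x) (f Q) p]
    rw [Subtype.dist_eq, Real.dist_eq, abs_lt] at h₄
    exact ⟨max_le (f x).2.1 (by linarith), le_min (f x).2.2 (by linarith)⟩
  obtain ⟨ζ₁, hζ₁, hf₁⟩ := hnear Q₁ hd₁ (hfκ false)
  obtain ⟨ζ₂, hζ₂, hf₂⟩ := hnear Q₂ hd₂ (hfκ true)
  obtain ⟨η, hη, hηη₀, hηζ₁, hηζ₂, hηq, hηhi⟩ : ∃ η > 0, η ≤ η₀ ∧ η ≤ ζ₁ ∧ η ≤ ζ₂ ∧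
      η ≤ (q₂ - q₁) / 2 ∧ η ≤ hi - q₂ := by
    refine ⟨min η₀ (min ζ₁ (min ζ₂ (min ((q₂ - q₁) / 2) (hi - q₂)))), ?_, ?_⟩
    · have h₁ : 0 < (q₂ - q₁) / 2 := by linarith
      have h₂ : 0 < hi - q₂ := by linarith
      positivity
    · simp
  obtain ⟨g₁, hg₁out, hg₁in, hg₁mid⟩ := exists_affine_on_middle_third f (q := q₁) (η := η) hlo₀ hlohi
    hhi₁ (by linarith) hη (by linarith) fun x h₁ h₂ => hf₁ x h₁ (h₂.trans (by
      change q₁ + η ≤ q₁ + ζ₁; linarith))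
  obtain ⟨g, hgout, hgin, hgmid⟩ := exists_affine_on_middle_third g₁ (q := q₂) (η := η) hlo₀ hlohi
    hhi₁ (by linarith) hη (by linarith) fun x h₁ h₂ => by
      rw [hg₁out x fun h => by linarith [h.2]]
      exact hf₂ x h₁ (h₂.trans (by change q₂ + η ≤ q₂ + ζ₂; linarith))
  -- the second change does not touch the first interval
  have hgg₁ : ∀ x : unitInterval, (x : ℝ) ≤ q₁ + η → g x = g₁ x := fun x hx =>
    hgout x fun h => by linarith [h.1]
  have hgout' : ∀ x : unitInterval, ¬ (q₁ < x ∧ (x : ℝ) < q₁ + η) →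
      ¬ (q₂ < x ∧ (x : ℝ) < q₂ + η) → g x = f x := fun x h₁ h₂ =>
    (hgout x h₂).trans (hg₁out x h₁)
  let q : Bool → ℝ := fun b => cond b q₂ q₁
  have hqlo : ∀ b, lo ≤ q b := by
    rintro (_ | _) <;> simp only [q, cond] <;> linarith
  have hqhi : ∀ b, q b + η ≤ hi := by
    rintro (_ | _) <;> simp only [q, cond] <;> linarith
  have hmid : ∀ b, ∀ x : unitInterval, q b + η / 3 ≤ x → (x : ℝ) ≤ q b + 2 * η / 3 →
      (g x : ℝ) = lo + (hi - lo) * (3 * ((x - q b) / η) - 1) := by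
    rintro (_ | _) x hx₁ hx₂
    · have hx₂' : (x : ℝ) ≤ q₁ + 2 * η / 3 := hx₂
      rw [hgg₁ x (by linarith)]
      exact hg₁mid x hx₁ hx₂
    · exact hgmid x hx₁ hx₂
  refine ⟨g, ⟨fun b => {x | q b + η / 3 ≤ (x : ℝ) ∧ (x : ℝ) ≤ q b + 2 * η / 3},
    fun b => ⟨?_, ?_, ?_, ?_⟩, ?_⟩, ?_, ?_⟩
  · exact (isClosed_le continuous_const continuous_subtype_val).inter
      (isClosed_le continuous_subtype_val continuous_const)
  · rintro x ⟨hx₁, hx₂⟩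
    exact ⟨by linarith [hqlo b], by linarith [hqhi b]⟩
  · rintro y ⟨hy₁, hy₂⟩
    let r : ℝ := (y - lo) / (hi - lo)
    have hr : (hi - lo) * r = y - lo := mul_div_cancel₀ _ (by linarith)
    have hr₀ : 0 ≤ r := div_nonneg (by linarith) (by linarith)
    have hr₁ : r ≤ 1 := div_le_one_of_le₀ (by linarith) (by linarith)
    have hx₁ : q b + η / 3 ≤ q b + η / 3 * (1 + r) := by nlinarith
    have hx₂ : q b + η / 3 * (1 + r) ≤ q b + 2 * η / 3 := by nlinarith
    refine ⟨⟨q b + η / 3 * (1 + r), by linarith [hqlo b], by linarith [hqhi b]⟩, ⟨hx₁, hx₂⟩,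
      Subtype.ext ?_⟩
    rw [hmid b _ hx₁ hx₂]
    have : (q b + η / 3 * (1 + r) - q b) / η = (1 + r) / 3 := by
      field_simp
      ring
    simp only [this]
    linarith
  · rintro x ⟨hx₁, hx₂⟩ y ⟨hy₁, hy₂⟩
    rw [Subtype.dist_eq, Subtype.dist_eq, Real.dist_eq, Real.dist_eq, hmid b x hx₁ hx₂,
      hmid b y hy₁ hy₂]
    have hdiff : lo + (hi - lo) * (3 * ((x - q b) / η) - 1) -
        (lo + (hi - lo) * (3 * ((y - q b) / η) - 1)) = 3 * ((hi - lo) / η) * ((x : ℝ) - y) := by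
      field_simp
      ring
    have hslope : 1 ≤ (hi - lo) / η := by
      rw [le_div_iff₀ hη]
      linarith [hqlo b, hqhi b]
    rw [hdiff, abs_mul, abs_of_pos (show 0 < 3 * ((hi - lo) / η) by linarith)]
    exact mul_le_mul_of_nonneg_right (by linarith) (abs_nonneg _)
  · rintro x ⟨hx₁, hx₂⟩ y ⟨hy₁, hy₂⟩
    rw [Subtype.dist_eq, Real.dist_eq, abs_sub_comm]
    have hx₂ : (x : ℝ) ≤ q₁ + 2 * η / 3 := hx₂
    have hy₁ : q₂ + η / 3 ≤ (y : ℝ) := hy₁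
    exact le_trans (by linarith) (le_abs_self _)
  · intro x
    have hclose : (lo ≤ f x ∧ (f x : ℝ) ≤ hi) → (lo ≤ g x ∧ (g x : ℝ) ≤ hi) →
        dist (f x) (g x) < δ := by
      rintro ⟨h₁, h₂⟩ ⟨h₃, h₄⟩
      rw [Subtype.dist_eq, Real.dist_eq, abs_lt]
      constructor <;> linarith
    by_cases h₁ : q₁ < x ∧ (x : ℝ) < q₁ + η
    · refine hclose (hf₁ x h₁.1.le (h₁.2.le.trans ?_)) ?_
      · change q₁ + η ≤ q₁ + ζ₁
        linarith
      · rw [hgg₁ x h₁.2.le]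
        exact hg₁in x h₁.1.le h₁.2.le
    · by_cases h₂ : q₂ < x ∧ (x : ℝ) < q₂ + η
      · refine hclose (hf₂ x h₂.1.le (h₂.2.le.trans ?_)) (hgin x h₂.1.le h₂.2.le)
        change q₂ + η ≤ q₂ + ζ₂
        linarith
      · rw [hgout' x h₁ h₂, dist_self]
        exact hδ
  · intro x hx
    refine hgout' x (fun h => hx false ⟨h.1, h.2.trans_le ?_⟩) fun h => hx true ⟨h.1, h.2.trans_le ?_⟩
    · change q₁ + η ≤ q₁ + η₀
      linarith
    · change q₂ + η ≤ q₂ + η₀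
      linarith

/-! ### Density of distributional chaos -/

theorem Nads.supDist_lt_of_forall_dist_lt {X : Type*} [TopologicalSpace X] [MetricSpace (Cs X)]
    {f g : Nads X} {ε : ℝ} (hε : 0 < ε) (h : ∀ n, dist (f n) (g n) < ε / 2) :
    Nads.supDist f g < ENNReal.ofReal ε := by
  refine lt_of_le_of_lt (iSup_le fun n => ?_)
    ((ENNReal.ofReal_lt_ofReal_iff hε).2 (half_lt_self hε))
  rw [edist_dist]
  exact ENNReal.ofReal_le_ofReal (h n).le

theorem theorem1 [MetricSpace (Cs unitInterval)] :
    (MetricUniformlyContinuousForSup unitInterval →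
      Nads.DenseIn Nads.IsDC1 {f : Nads unitInterval | f.ConvergesPointwise}) ∧
    (MetricContinuousForSup unitInterval →
      Nads.DenseIn Nads.IsDC1 {f : Nads unitInterval | f.ConvergesInMetric}) := by
  constructor
  · rintro hρ f ⟨φ, hφ⟩ ε hε
    obtain ⟨δ, hδ, hclose⟩ := hρ (ε / 2) (half_pos hε)
    obtain ⟨J, t, κ, q, hJ, ht, hκ, hpert⟩ := exists_horseshoe_perturbation φ hδ
    obtain ⟨N, hN⟩ : ∃ N, ∀ n ≥ N, ∀ b, dist (f n (q b)) (φ (q b)) < κ :=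
      eventually_atTop.1 (eventually_all.2 fun b => Metric.tendsto_nhds.1 (hφ (q b)) κ hκ)
    have : Nonempty (Cs unitInterval) := ⟨f 0⟩
    -- the supports of the changes shrink, so that the pointwise limit stays the same
    choose! G hG using fun n (hn : n ≥ N) =>
      hpert (f n) (hN n hn) (1 / ((n : ℝ) + 1)) Nat.one_div_pos_of_nat
    let g : Nads unitInterval := fun n => if n < N then f n else G n
    have hg : ∀ n ≥ N, g n = G n := fun n hn => if_neg hn.not_gt
    refine ⟨g, ⟨φ, fun x => ?_⟩, Nads.isDC1_of_hasHorseshoe hJ ht (N := N) fun n hn => ?_,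
      Nads.supDist_lt_of_forall_dist_lt hε fun n => ?_⟩
    · have hev : ∀ᶠ n : ℕ in atTop,
          ∀ b, ¬ ((q b : ℝ) < x ∧ (x : ℝ) < q b + 1 / ((n : ℝ) + 1)) := by
        refine eventually_all.2 fun b => ?_
        by_cases hx : (q b : ℝ) < x
        · filter_upwards [tendsto_one_div_add_atTop_nhds_zero_nat.eventually_lt_const
            (sub_pos.2 hx)] with n hn h
          linarith [h.2]
        · exact .of_forall fun n h => hx h.1
      refine (hφ x).congr' ?_
      filter_upwards [hev, eventually_ge_atTop N] with n hn hnN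
      rw [hg n hnN]
      exact ((hG n hnN).2.2 x hn).symm
    · rw [hg n hn]
      exact (hG n hn).1
    · by_cases hn : n < N
      · simp only [g, if_pos hn, dist_self]
        exact half_pos hε
      · rw [hg n (not_lt.1 hn)]
        exact hclose _ _ (hG n (not_lt.1 hn)).2.1
  · rintro hρ f ⟨φ, hφ⟩ ε hε
    have hε₄ : 0 < ε / 4 := by linarith
    obtain ⟨δ, hδ, hclose⟩ := hρ φ (ε / 4) hε₄
    obtain ⟨J, t, κ, q, hJ, ht, hκ, hpert⟩ := exists_horseshoe_perturbation φ.1 hδ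
    -- from some time on, all maps are replaced by one perturbation of the limit
    obtain ⟨G, hG, hGδ, -⟩ := hpert φ (fun b => by rwa [dist_self]) 1 one_pos
    obtain ⟨N, hN⟩ := hφ (ε / 4) hε₄
    let g : Nads unitInterval := fun n => if n ≤ N then f n else G
    have hg : ∀ n > N, g n = G := fun n hn => if_neg hn.not_ge
    refine ⟨g, ⟨G, fun r hr => ⟨N, fun n hn => ?_⟩⟩,
      Nads.isDC1_of_hasHorseshoe hJ ht (N := N + 1) fun n hn => ?_,
      Nads.supDist_lt_of_forall_dist_lt hε fun n => ?_⟩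
    · rwa [hg n hn, dist_self]
    · rw [hg n hn]
      exact hG
    · by_cases hn : n ≤ N
      · simp only [g, if_pos hn, dist_self]
        exact half_pos hε
      · rw [hg n (not_le.1 hn)]
        have h₁ := hN n (not_le.1 hn)
        have h₂ := hclose G hGδ
        linarith [dist_triangle (f n) φ G]
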